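/- Consider $N$ consumers and $T$ time slots. The retailer has capacity $U$ and a cost function $C:[0,\infty)\to[0,\infty]$ with $C(0)=0$, such that $C$ is finite and differentiable on $[0,U)$ (one-sided at $0$), its derivative, the marginal cost $\mathcal C=C'$, is non-negative and non-decreasing, $C(U)=\lim_{x\uparrow U}C(x)\in[0,\infty]$, and $C(x)=\mathcal C(x)=\infty$ for $x>U$. (At $U$, $\mathcal C(U)\in[0,\infty]$ is any value for which $\mathcal C$ is non-decreasing on $[0,\infty)$.) Consumer $i$ chooses demands $x_i=(x_i^1,\dots,x_i^T)$ with $x_i^t\ge 0$ and $\sum_t x_i^t\ge\beta_i$, where $\beta_i\ge 0$ is its minimum daily requirement. Put $x^t=(x_1^t,\dots,x_N^t)$ and $X^t=\sum_i x_i^t$. In slot $t$ consumer $i$ pays - under average-cost pricing: $M_i^t(x^t)=x_i^t\,C(X^t)/X^t$ (and $0$ if $x_i^t=0$); - under time-variant increasing-block pricing: $M_i^t(x^t)=\int_0^{x_i^t}\mathcal C\big(\sum_j\min(s,x_j^t)\big)\,ds$. It earns $E_i^t=0$ in the zero-revenue model and $E_i^t=\omega_i^t x_i^t$, with constants $\omega_i^t\ge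 0$, in the constant-rate revenue model. Its payoff is $\pi_i(x)=\sum_t (E_i^t-M_i^t)\in[-\infty,\infty)$. A Nash equilibrium point (NEP) is a profile of admissible strategies at which no consumer can increase its payoff by changing only its own strategy to another admissible one. Then for each of the two pricing schemes: 1. (Zero revenue) If $\beta_i\ge0$ for all $i$ and $\sum_i\beta_i<TU$, the game has an NEP. 2. (Constant-rate revenue) If $\beta_i=0$ for all $i$, $\omega_i^t\ge 0$ for all $i,t$, and $0<TU$, the game has an NEP. In each case the NEP can be chosen with $X^t\le U$ for every $t$ and with all payments $M_i^t$ finite. -/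

import Mathlib

open scoped ENNReal


namespace LoadBalancing

/-- `C` is the retailer's cost function (with values in `[0, ∞]`) for a market of capacity `U`, and
`c` is the corresponding marginal cost function: `c = C'` wherever the load is below the capacity
(one-sided derivative at `0`), `c` is non-negative and non-decreasing, and both functions are
infinite above the capacity.  At the threshold `U` itself `C` is the limit from the left, which may
be finite or infinite.  Only the values at loads `x ≥ 0` are constrained. -/
structure IsCostFunction (U : ℝ) (C c : ℝ → ℝ≥0∞) : Prop where
  cost_zero : C 0 = 0
  cost_ne_top : ∀ x, 0 ≤ x → x < U → C x ≠ ⊤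
  marginal_ne_top : ∀ x, 0 ≤ x → x < U → c x ≠ ⊤
  hasDerivWithinAt : ∀ x, 0 ≤ x → x < U →
    HasDerivWithinAt (fun y : ℝ => (C y).toReal) (c x).toReal (Set.Ici 0) x
  marginal_mono : MonotoneOn c (Set.Ici 0)
  left_continuous : ContinuousWithinAt C (Set.Iic U) U
  cost_eq_top : ∀ x, U < x → C x = ⊤
  marginal_eq_top : ∀ x, U < x → c x = ⊤

variable {N T : ℕ}

/-- The total load of a demand vector `q` (the demands of all consumers in one time slot). -/
def load (q : Fin N → ℝ) : ℝ := ∑ j, q j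

/-- The average cost `A(X) = C(X) / X` of electricity. -/
noncomputable def averageCost (C : ℝ → ℝ≥0∞) (X : ℝ) : ℝ≥0∞ := C X / ENNReal.ofReal X

/-- Average-cost pricing: consumer `i` pays `q i * A(∑ j, q j)` (and nothing if `q i = 0`). -/
noncomputable def averageCostPayment (C : ℝ → ℝ≥0∞) (q : Fin N → ℝ) (i : Fin N) : ℝ≥0∞ :=
  ENNReal.ofReal (q i) * averageCost C (load q)

/-- The marginal cost function `M(s, q) = c (∑ j, min (s, q j))` posed to the consumers under
time-variant increasing-block pricing. -/
noncomputable def blockMarginal (c : ℝ → ℝ≥0∞) (s : ℝ) (q : Fin N → ℝ) : ℝ≥0∞ :=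
  c (∑ j, min s (q j))

/-- Time-variant increasing-block pricing: consumer `i` pays `∫_0^{q i} M(s, q) ds`. -/
noncomputable def increasingBlockPayment (c : ℝ → ℝ≥0∞) (q : Fin N → ℝ) (i : Fin N) : ℝ≥0∞ :=
  ∫⁻ s in Set.Ioc 0 (q i), blockMarginal c s q

/-- The two pricing schemes. -/
inductive PricingScheme where
  | averageCost
  | increasingBlock

/-- The payment of consumer `i` in a time slot with demand vector `q`. -/
noncomputable def PricingScheme.payment (s : PricingScheme) (C c : ℝ → ℝ≥0∞)
    (q : Fin N → ℝ) (i : Fin N) : ℝ≥0∞ :=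
  match s with
  | .averageCost => averageCostPayment C q i
  | .increasingBlock => increasingBlockPayment c q i

/-- The zero-revenue model. -/
def zeroRevenue (_ : Fin N) (_ : Fin T) (_ : ℝ) : ℝ := 0

/-- The constant-rate revenue model: in slot `t`, consumer `i` earns `ω i t` per unit. -/
def constantRateRevenue (ω : Fin N → Fin T → ℝ) (i : Fin N) (t : Fin T) (d : ℝ) : ℝ := ω i t * d

/-- The payoff `∑ t, (revenue - payment)` of consumer `i` at the demand profile `x`
(`x j t` is the demand of consumer `j` in slot `t`); it is `-∞` if some payment is infinite. -/
noncomputable def payoff (pay : (Fin N → ℝ) → Fin N → ℝ≥0∞) (rev : Fin N → Fin T → ℝ → ℝ)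
    (x : Fin N → Fin T → ℝ) (i : Fin N) : EReal :=
  ∑ t, (((rev i t (x i t) : ℝ) : EReal) - ((pay (fun j => x j t) i : ℝ≥0∞) : EReal))

/-- The strategies of a consumer with minimum total daily requirement `b`. -/
def strategySet (T : ℕ) (b : ℝ) : Set (Fin T → ℝ) :=
  {d | (∀ t, 0 ≤ d t) ∧ b ≤ ∑ t, d t}

/-- `x` is a Nash equilibrium point: every consumer plays a strategy from its strategy set, and no
consumer can raise its payoff by a unilateral change of strategy. -/
def IsNEP (pay : (Fin N → ℝ) → Fin N → ℝ≥0∞) (rev : Fin N → Fin T → ℝ → ℝ)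
    (β : Fin N → ℝ) (x : Fin N → Fin T → ℝ) : Prop :=
  (∀ i, x i ∈ strategySet T (β i)) ∧
    ∀ i, ∀ d ∈ strategySet T (β i),
      payoff pay rev (Function.update x i d) i ≤ payoff pay rev x i

/-- At `x` the load never exceeds the capacity `U`, and all payments are finite. -/
def IsServable (pay : (Fin N → ℝ) → Fin N → ℝ≥0∞) (U : ℝ) (x : Fin N → Fin T → ℝ) : Prop :=
  (∀ t, load (fun j => x j t) ≤ U) ∧ ∀ i t, pay (fun j => x j t) i ≠ ⊤

end LoadBalancing

/-!
If in every time slot the payment of each consumer, as a function of its own demand, has a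
subgradient (its marginal price) at the profile `x`, then the payoff of any deviation is bounded by
its linearization, so `x` is an equilibrium as soon as no consumer gains in the linearized game.

Without revenue, spreading each requirement evenly over the slots makes the marginal prices
non-negative and independent of the slot, which suffices. With constant revenue rates it suffices
to find, slot by slot, demands `q` whose marginal prices are the rates `ω i`.
* Under increasing-block pricing the marginal price of consumer `i` is the marginal cost at the load
  `∑ j, min (q i) (q j)`. Inverting the marginal cost at `ω i` prescribes this load for every `i`,
  and such a system of equations always has a solution `q`.
* Under average-cost pricing, if `κ` is a subgradient of the cost at the load `X` and `a` is the
  average cost, the marginal price is `a + q i / X * (κ - a)`. Equating it with `ω i` where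
  `q i > 0` and summing over `i` leaves one equation, `κ = a + ∑ i, (ω i - a)⁺`, for `X`. Since a
  non-decreasing derivative is continuous, it is solved by the intermediate value theorem, or by
  `X = U`, where `κ` may be any number above the marginal costs of smaller loads.
-/

namespace LoadBalancing

open Set Filter Topology MeasureTheory

/-- `κ` is a subgradient at `x` of the extended-valued function `f` on `[0, ∞)`; the values of `f`
at negative arguments play no role, and `f` is required to be finite at `x`. -/
def IsSubgradient (f : ℝ → ℝ≥0∞) (x κ : ℝ) : Prop :=
  f x ≠ ⊤ ∧ ∀ z, 0 ≤ z → f z ≠ ⊤ → (f x).toReal + κ * (z - x) ≤ (f z).toReal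

namespace IsSubgradient

variable {f g : ℝ → ℝ≥0∞} {x κ κ' : ℝ}

theorem congr (h : IsSubgradient f x κ) (hx : 0 ≤ x) (hfg : EqOn f g (Ici 0)) :
    IsSubgradient g x κ :=
  ⟨hfg hx ▸ h.1, fun z hz => hfg hx ▸ hfg hz ▸ h.2 z hz⟩

theorem mono_at_zero (h : IsSubgradient f 0 κ) (hκ : κ' ≤ κ) : IsSubgradient f 0 κ' := by
  refine ⟨h.1, fun z hz hfz => le_trans ?_ (h.2 z hz hfz)⟩
  gcongr

theorem coe_le (h : IsSubgradient f x κ) {z : ℝ} (hz : 0 ≤ z) :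
    (((f x).toReal + κ * (z - x) : ℝ) : EReal) ≤ f z := by
  by_cases hfz : f z = ⊤
  · simp [hfz]
  · rw [← EReal.coe_ennreal_toReal hfz, EReal.coe_le_coe_iff]
    exact h.2 z hz hfz

theorem div_le (h : IsSubgradient f x κ) (hf : f 0 = 0) (hx : 0 < x) : (f x).toReal / x ≤ κ := by
  have h0 := h.2 0 le_rfl (by simp [hf])
  rw [hf, ENNReal.toReal_zero] at h0
  rw [div_le_iff₀ hx]
  linarith

end IsSubgradient

section MonotoneDerivative

variable {s : Set ℝ} {f f' : ℝ → ℝ}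

theorem tangent_le_of_monotoneOn_deriv (hs : Convex ℝ s)
    (hf : ∀ y ∈ s, HasDerivWithinAt f (f' y) s y) (hf' : MonotoneOn f' s) {x z : ℝ} (hx : x ∈ s)
    (hz : z ∈ s) : f x + f' x * (z - x) ≤ f z := by
  have hderiv : ∀ y ∈ interior s, HasDerivAt f (f' y) y := fun y hy =>
    (hf y (interior_subset hy)).hasDerivAt (mem_interior_iff_mem_nhds.1 hy)
  have hconvex : ConvexOn ℝ s f :=
    MonotoneOn.convexOn_of_deriv hs (fun y hy => (hf y hy).continuousWithinAt)
      (fun y hy => (hderiv y hy).differentiableAt.differentiableWithinAt)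
      ((hf'.mono interior_subset).congr fun y hy => (hderiv y hy).deriv.symm)
  rcases lt_trichotomy x z with hxz | rfl | hzx
  · have := hconvex.le_slope_of_hasDerivWithinAt hx hz hxz (hf x hx)
    rw [slope_def_field, le_div_iff₀ (sub_pos.2 hxz)] at this
    linarith
  · simp
  · have := hconvex.slope_le_of_hasDerivWithinAt hz hx hzx (hf x hx)
    rw [slope_def_field, div_le_iff₀ (sub_pos.2 hzx)] at this
    linarith

theorem eventually_lt_of_monotoneOn_of_ordConnected_image {α β : Type*} [LinearOrder α]
    [TopologicalSpace α] [OrderTopology α] [LinearOrder β] [DenselyOrdered β] {s : Set α}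
    {f : α → β} (hf : MonotoneOn f s) (hfs : (f '' s).OrdConnected) {x : α} (hx : x ∈ s) {b : β}
    (hb : b < f x) : ∀ᶠ y in 𝓝[s] x, b < f y := by
  by_cases hw : ∃ w ∈ s, w < x ∧ b < f w
  · obtain ⟨w, hws, hwx, hbw⟩ := hw
    filter_upwards [self_mem_nhdsWithin, nhdsWithin_le_nhds (Ioi_mem_nhds hwx)] with y hys hwy
    exact hbw.trans_le (hf hws hys (le_of_lt hwy))
  · push Not at hw
    filter_upwards [self_mem_nhdsWithin] with y hys
    by_contra! hyb
    obtain ⟨v, hbv, hvx⟩ := exists_between hb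
    obtain ⟨w, hws, rfl⟩ := hfs.out (mem_image_of_mem f hys) (mem_image_of_mem f hx)
      ⟨hyb.trans hbv.le, hvx.le⟩
    exact hbv.not_ge (hw w hws (hf.reflect_lt hws hx hvx))

theorem continuousOn_of_monotoneOn_of_ordConnected_image {α β : Type*} [LinearOrder α]
    [TopologicalSpace α] [OrderTopology α] [LinearOrder β] [DenselyOrdered β]
    [TopologicalSpace β] [OrderTopology β] {s : Set α} {f : α → β} (hf : MonotoneOn f s)
    (hfs : (f '' s).OrdConnected) : ContinuousOn f s := fun _ hx =>
  tendsto_order.2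
    ⟨fun _ => eventually_lt_of_monotoneOn_of_ordConnected_image hf hfs hx,
      fun _ => eventually_lt_of_monotoneOn_of_ordConnected_image (α := αᵒᵈ) (β := βᵒᵈ) hf.dual
        hfs.dual hx⟩

theorem continuousOn_deriv_of_monotoneOn (hs : s.OrdConnected)
    (hf : ∀ y ∈ s, HasDerivWithinAt f (f' y) s y) (hf' : MonotoneOn f' s) : ContinuousOn f' s :=
  continuousOn_of_monotoneOn_of_ordConnected_image hf' (hs.image_hasDerivWithinAt hf)

end MonotoneDerivative

theorem exists_threshold_of_monotoneOn {α β : Type*} [ConditionallyCompleteLinearOrder α]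
    [LinearOrder β] {f : α → β} {a b : α} (hab : a ≤ b) (hf : MonotoneOn f (Icc a b)) (v : β) :
    ∃ y ∈ Icc a b, (∀ z ∈ Ico a y, f z ≤ v) ∧ ∀ z ∈ Ioc y b, v ≤ f z := by
  set S : Set α := insert a {z ∈ Icc a b | f z ≤ v}
  have hS : S ⊆ Icc a b := insert_subset (left_mem_Icc.2 hab) fun z hz => hz.1
  have hbdd : BddAbove S := bddAbove_Icc.mono hS
  have hay : a ≤ sSup S := le_csSup hbdd (mem_insert a _)
  refine ⟨sSup S, ⟨hay, csSup_le (insert_nonempty a _) fun z hz => (hS hz).2⟩, ?_, ?_⟩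
  · rintro z ⟨haz, hz⟩
    obtain ⟨w, rfl | ⟨hw, hwv⟩, hzw⟩ := exists_lt_of_lt_csSup (insert_nonempty a _) hz
    · exact absurd hzw haz.not_gt
    · exact (hf ⟨haz, hzw.le.trans hw.2⟩ hw hzw.le).trans hwv
  · rintro z ⟨hz, hzb⟩
    by_contra! hzv
    exact hz.not_ge (le_csSup hbdd (mem_insert_of_mem a ⟨⟨hay.trans hz.le, hzb⟩, hzv.le⟩))

theorem setLIntegral_Ioc_add_adjacent (f : ℝ → ℝ≥0∞) {a b c : ℝ} (hab : a ≤ b) (hbc : b ≤ c) :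
    (∫⁻ s in Ioc a b, f s) + ∫⁻ s in Ioc b c, f s = ∫⁻ s in Ioc a c, f s := by
  rw [← Ioc_union_Ioc_eq_Ioc hab hbc,
    lintegral_union measurableSet_Ioc (Ioc_disjoint_Ioc_of_le le_rfl)]

section MonotoneIntegrand

variable {f : ℝ → ℝ≥0∞} {a b l : ℝ}

theorem setLIntegral_Ioc_le_ofReal (hl : 0 ≤ l) (h : ∀ s ∈ Ioo a b, f s ≤ ENNReal.ofReal l) :
    ∫⁻ s in Ioc a b, f s ≤ ENNReal.ofReal (l * (b - a)) := by
  rw [← setLIntegral_congr Ioo_ae_eq_Ioc, ENNReal.ofReal_mul hl, ← Real.volume_Ioo,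
    ← setLIntegral_const]
  exact setLIntegral_mono measurable_const h

theorem ofReal_le_setLIntegral_Ioc (hl : 0 ≤ l) (h : ∀ s ∈ Ioc a b, ENNReal.ofReal l ≤ f s) :
    ENNReal.ofReal (l * (b - a)) ≤ ∫⁻ s in Ioc a b, f s := by
  rw [ENNReal.ofReal_mul hl, ← Real.volume_Ioc, ← setLIntegral_const]
  exact setLIntegral_mono' measurableSet_Ioc h

theorem isSubgradient_setLIntegral_Ioc {x : ℝ} (hx : 0 ≤ x) (hl : 0 ≤ l)
    (hlow : ∀ s ∈ Ioo 0 x, f s ≤ ENNReal.ofReal l) (hhigh : ∀ s, x < s → ENNReal.ofReal l ≤ f s) :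
    IsSubgradient (fun d => ∫⁻ s in Ioc 0 d, f s) x l := by
  refine ⟨ne_top_of_le_ne_top ENNReal.ofReal_ne_top (setLIntegral_Ioc_le_ofReal hl hlow), ?_⟩
  intro z hz hfin
  dsimp only at hfin ⊢
  rcases le_total z x with hzx | hxz
  · have hle : ∫⁻ s in Ioc z x, f s ≤ ENNReal.ofReal (l * (x - z)) :=
      setLIntegral_Ioc_le_ofReal hl fun s hs => hlow s ⟨hz.trans_lt hs.1, hs.2⟩
    have hle_real := ENNReal.toReal_le_of_le_ofReal (mul_nonneg hl (sub_nonneg.2 hzx)) hle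
    rw [← setLIntegral_Ioc_add_adjacent f hz hzx,
      ENNReal.toReal_add hfin (ne_top_of_le_ne_top ENNReal.ofReal_ne_top hle)]
    linarith
  · have hle : ENNReal.ofReal (l * (z - x)) ≤ ∫⁻ s in Ioc x z, f s :=
      ofReal_le_setLIntegral_Ioc hl fun s hs => hhigh s hs.1
    rw [← setLIntegral_Ioc_add_adjacent f hx hxz, ENNReal.add_ne_top] at hfin
    have hle_real := (ENNReal.ofReal_le_iff_le_toReal hfin.2).1 hle
    rw [← setLIntegral_Ioc_add_adjacent f hx hxz, ENNReal.toReal_add hfin.1 hfin.2]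
    linarith

end MonotoneIntegrand

theorem monotone_setIntegral_Ico {g : ℝ → ℝ} (hg : 0 ≤ g) (a : ℝ)
    (hint : ∀ b, IntegrableOn g (Ico a b)) : Monotone fun b => ∫ z in Ico a b, g z := fun _ c hbc =>
  setIntegral_mono_set (hint c) (ae_of_all _ hg) (Ico_subset_Ico_right hbc).eventuallyLE

theorem sum_indicator_inv_card {ι : Type*} [Fintype ι] (y : ι → ℝ) {i : ι} {z : ℝ} (hz : z < y i) :
    ∑ j, (Iio (y j)).indicator (fun w => ((Finset.univ.filter (w < y ·)).card : ℝ)⁻¹) z = 1 := by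
  have hcard : ((Finset.univ.filter (z < y ·)).card : ℝ) ≠ 0 :=
    Nat.cast_ne_zero.2 (Finset.card_ne_zero_of_mem (Finset.mem_filter.2 ⟨Finset.mem_univ i, hz⟩))
  simp only [indicator_apply, mem_Iio, ← Finset.sum_filter, Finset.sum_const, nsmul_eq_mul,
    mul_inv_cancel₀ hcard]

theorem exists_sum_min_eq {ι : Type*} [Fintype ι] {y : ι → ℝ} (hy : ∀ i, 0 ≤ y i) :
    ∃ q : ι → ℝ, (∀ i, 0 ≤ q i) ∧ ∀ i, ∑ j, min (q i) (q j) = y i := by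
  -- `q i = ∫ z in [0, y i), 1 / #{j | z < y j}`: at load `z` the level rises at rate `1 / n` while
  -- `n` consumers are still unserved.
  set g : ℝ → ℝ := fun z => ((Finset.univ.filter (z < y ·)).card : ℝ)⁻¹
  have hg : 0 ≤ g := fun z => by positivity
  have hmeas : Measurable g := by
    have : Antitone fun z => ((Finset.univ.filter (z < y ·)).card : ℝ) := fun z w hzw =>
      Nat.cast_le.2 <| Finset.card_le_card <|
        Finset.monotone_filter_right _ fun j _ hj => hzw.trans_lt hj
    exact this.measurable.inv
  have hint : ∀ b, IntegrableOn g (Ico 0 b) := fun b =>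
    Measure.integrableOn_of_bounded (M := 1) measure_Ico_lt_top.ne hmeas.aestronglyMeasurable
      (ae_of_all _ fun z => by
        rw [Real.norm_of_nonneg (hg z)]
        exact Nat.cast_inv_le_one _)
  refine ⟨fun i => ∫ z in Ico 0 (y i), g z,
    fun i => setIntegral_nonneg measurableSet_Ico fun z _ => hg z, fun i => ?_⟩
  calc ∑ j, min (∫ z in Ico 0 (y i), g z) (∫ z in Ico 0 (y j), g z)
      = ∑ j, ∫ z in Ico 0 (min (y i) (y j)), g z :=
        Finset.sum_congr rfl fun j _ => ((monotone_setIntegral_Ico hg 0 hint).map_min).symm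
    _ = ∑ j, ∫ z in Ico 0 (y i), (Iio (y j)).indicator g z := by
        simp only [setIntegral_indicator measurableSet_Iio, Ico_inter_Iio]
    _ = ∫ z in Ico 0 (y i), ∑ j, (Iio (y j)).indicator g z :=
        (integral_finsetSum _ fun j _ => (hint (y i)).indicator measurableSet_Iio).symm
    _ = ∫ _ in Ico 0 (y i), 1 :=
        setIntegral_congr_fun measurableSet_Ico fun z hz => sum_indicator_inv_card y hz.2
    _ = y i := by simp [hy i]

variable {N T : ℕ}

section NashEquilibrium

variable {pay : (Fin N → ℝ) → Fin N → ℝ≥0∞}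

/-- `p i` is a marginal price that consumer `i` faces at the demand vector `q` of a time slot: a
subgradient of the payment of `i` as a function of its own demand. -/
def IsMarginalPrice (pay : (Fin N → ℝ) → Fin N → ℝ≥0∞) (q p : Fin N → ℝ) : Prop :=
  ∀ i, IsSubgradient (fun d => pay (Function.update q i d) i) (q i) (p i)

theorem IsMarginalPrice.ne_top {q p : Fin N → ℝ} (h : IsMarginalPrice pay q p) (i : Fin N) :
    pay q i ≠ ⊤ := by
  simpa using (h i).1

theorem IsMarginalPrice.mono {q p p' : Fin N → ℝ} (h : IsMarginalPrice pay q p)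
    (hp : ∀ i, p' i = p i ∨ q i = 0 ∧ p' i ≤ p i) : IsMarginalPrice pay q p' := by
  intro i
  rcases hp i with heq | ⟨hq, hle⟩
  · exact heq ▸ h i
  · exact hq ▸ (hq ▸ h i : IsSubgradient _ 0 (p i)).mono_at_zero hle

theorem coe_sum_ereal {ι : Type*} (s : Finset ι) (f : ι → ℝ) :
    ((∑ t ∈ s, f t : ℝ) : EReal) = ∑ t ∈ s, (f t : EReal) :=
  map_sum (⟨⟨Real.toEReal, EReal.coe_zero⟩, EReal.coe_add⟩ : ℝ →+ EReal) f s

theorem payoff_eq_coe {rev : Fin N → Fin T → ℝ → ℝ} {x : Fin N → Fin T → ℝ} {i : Fin N}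
    (h : ∀ t, pay (fun j => x j t) i ≠ ⊤) :
    payoff pay rev x i =
      ((∑ t, (rev i t (x i t) - (pay (fun j => x j t) i).toReal) : ℝ) : EReal) := by
  simp only [payoff, coe_sum_ereal, EReal.coe_sub]
  exact Finset.sum_congr rfl fun t _ => by rw [EReal.coe_ennreal_toReal (h t)]

theorem isNEP_of_isMarginalPrice {rev : Fin N → Fin T → ℝ → ℝ} {β : Fin N → ℝ}
    {x p : Fin N → Fin T → ℝ} (hx : ∀ i, x i ∈ strategySet T (β i))
    (hp : ∀ t, IsMarginalPrice pay (fun j => x j t) (fun j => p j t))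
    (hlin : ∀ i, ∀ d ∈ strategySet T (β i),
      ∑ t, (rev i t (d t) - p i t * (d t - x i t)) ≤ ∑ t, rev i t (x i t)) :
    IsNEP pay rev β x := by
  refine ⟨hx, fun i d hd => ?_⟩
  have hslot : ∀ t, (fun j => Function.update x i d j t) =
      Function.update (fun j => x j t) i (d t) := fun t =>
    funext fun j => Function.apply_update (fun _ e => e t) x i d j
  have hpay : ∀ t, (((pay (fun j => x j t) i).toReal + p i t * (d t - x i t) : ℝ) : EReal) ≤
      pay (Function.update (fun j => x j t) i (d t)) i := fun t => by
    simpa using (hp t i).coe_le (hd.1 t)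
  calc payoff pay rev (Function.update x i d) i
      = ∑ t, ((rev i t (d t) : EReal) - pay (Function.update (fun j => x j t) i (d t)) i) := by
        simp only [payoff, hslot, Function.update_self]
    _ ≤ ∑ t, ((rev i t (d t) -
          ((pay (fun j => x j t) i).toReal + p i t * (d t - x i t)) : ℝ) : EReal) :=
        Finset.sum_le_sum fun t _ => by
          rw [EReal.coe_sub]
          exact EReal.sub_le_sub le_rfl (hpay t)
    _ ≤ ((∑ t, (rev i t (x i t) - (pay (fun j => x j t) i).toReal) : ℝ) : EReal) := by
        rw [← coe_sum_ereal, EReal.coe_le_coe_iff]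
        have := hlin i d hd
        simp only [Finset.sum_sub_distrib, Finset.sum_add_distrib] at this ⊢
        linarith
    _ = payoff pay rev x i := (payoff_eq_coe fun t => (hp t).ne_top i).symm

theorem exists_isNEP_zeroRevenue {U : ℝ} {β p : Fin N → ℝ} (hT : 0 < T) (hβ : ∀ i, 0 ≤ β i)
    (hload : load (fun i => β i / T) ≤ U) (hp0 : ∀ i, 0 ≤ p i)
    (hp : IsMarginalPrice pay (fun i => β i / T) p) :
    ∃ x : Fin N → Fin T → ℝ, IsNEP pay zeroRevenue β x ∧ IsServable pay U x := by
  have hβT : ∀ i, (T : ℝ) * (β i / T) = β i := fun i =>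
    mul_div_cancel₀ _ (Nat.cast_ne_zero.2 hT.ne')
  refine ⟨fun i _ => β i / T, isNEP_of_isMarginalPrice (p := fun i _ => p i) (fun i => ?_)
    (fun _ => hp) (fun i d hd => ?_), fun _ => hload, fun i _ => hp.ne_top i⟩
  · exact ⟨fun _ => div_nonneg (hβ i) T.cast_nonneg, by simp [hβT]⟩
  · have hcost : 0 ≤ p i * (∑ t, d t - β i) := mul_nonneg (hp0 i) (sub_nonneg.2 hd.2)
    simpa [zeroRevenue, ← Finset.mul_sum, Finset.sum_sub_distrib, hβT] using hcost

theorem exists_isNEP_constantRateRevenue {U : ℝ} {ω : Fin N → Fin T → ℝ}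
    (h : ∀ t, ∃ q : Fin N → ℝ,
      (∀ i, 0 ≤ q i) ∧ load q ≤ U ∧ IsMarginalPrice pay q (fun i => ω i t)) :
    ∃ x : Fin N → Fin T → ℝ,
      IsNEP pay (constantRateRevenue ω) (fun _ => 0) x ∧ IsServable pay U x := by
  choose q hq hload hω using h
  refine ⟨fun i t => q t i, isNEP_of_isMarginalPrice (p := ω) (fun i => ?_) hω fun i d _ => ?_,
    hload, fun i t => (hω t).ne_top i⟩
  · exact ⟨fun t => hq t i, Finset.sum_nonneg fun t _ => hq t i⟩
  · refine (Finset.sum_congr rfl fun t _ => ?_).le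
    simp only [constantRateRevenue]
    ring

end NashEquilibrium

section IncreasingBlock

/-- The load of all demand blocks below the level `s`, when the others demand `q` and consumer `i`
demands at least `s`; the marginal cost at this load is what `i` pays for its block at level `s`. -/
def levelLoad (q : Fin N → ℝ) (i : Fin N) (s : ℝ) : ℝ := s + ∑ j ∈ Finset.univ.erase i, min s (q j)

variable {q : Fin N → ℝ}

theorem levelLoad_self (q : Fin N → ℝ) (i : Fin N) :
    levelLoad q i (q i) = ∑ j, min (q i) (q j) := by
  rw [levelLoad, ← Finset.add_sum_erase _ _ (Finset.mem_univ i), min_self]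

theorem levelLoad_strictMono (q : Fin N → ℝ) (i : Fin N) : StrictMono (levelLoad q i) :=
  fun _ _ h => add_lt_add_of_lt_of_le h (Finset.sum_le_sum fun _ _ => min_le_min_right _ h.le)

theorem levelLoad_nonneg (hq : ∀ j, 0 ≤ q j) (i : Fin N) {s : ℝ} (hs : 0 ≤ s) :
    0 ≤ levelLoad q i s :=
  add_nonneg hs (Finset.sum_nonneg fun j _ => le_min hs (hq j))

theorem sum_min_update (q : Fin N → ℝ) (i : Fin N) {s d : ℝ} (h : s ≤ d) :
    ∑ j, min s (Function.update q i d j) = levelLoad q i s := by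
  rw [levelLoad, ← Finset.add_sum_erase _ _ (Finset.mem_univ i), Function.update_self,
    min_eq_left h]
  congr 1
  exact Finset.sum_congr rfl fun j hj => by rw [Function.update_of_ne (Finset.ne_of_mem_erase hj)]

theorem increasingBlockPayment_update (c : ℝ → ℝ≥0∞) (q : Fin N → ℝ) (i : Fin N) (d : ℝ) :
    increasingBlockPayment c (Function.update q i d) i =
      ∫⁻ s in Ioc 0 d, c (levelLoad q i s) := by
  rw [increasingBlockPayment, Function.update_self]
  refine setLIntegral_congr_fun measurableSet_Ioc fun s hs => ?_
  simp only [blockMarginal, sum_min_update q i hs.2]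

variable {c : ℝ → ℝ≥0∞}

theorem isMarginalPrice_increasingBlockPayment {p : Fin N → ℝ} (hq : ∀ i, 0 ≤ q i)
    (hp : ∀ i, 0 ≤ p i)
    (hlow : ∀ i, ∀ z ∈ Ico 0 (∑ j, min (q i) (q j)), c z ≤ ENNReal.ofReal (p i))
    (hhigh : ∀ i z, ∑ j, min (q i) (q j) < z → ENNReal.ofReal (p i) ≤ c z) :
    IsMarginalPrice (increasingBlockPayment c) q p := by
  intro i
  simp only [increasingBlockPayment_update]
  refine isSubgradient_setLIntegral_Ioc (hq i) (hp i) (fun s hs => ?_) fun s hs => ?_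
  · refine hlow i _ ⟨levelLoad_nonneg hq i hs.1.le, ?_⟩
    exact levelLoad_self q i ▸ levelLoad_strictMono q i hs.2
  · exact hhigh i _ (levelLoad_self q i ▸ levelLoad_strictMono q i hs)

theorem exists_isMarginalPrice_increasingBlockPayment (hc : MonotoneOn c (Ici 0))
    (hq : ∀ i, 0 ≤ q i) (hfin : ∀ z, 0 ≤ z → z ≤ load q → c z ≠ ⊤) :
    ∃ p : Fin N → ℝ, (∀ i, 0 ≤ p i) ∧ IsMarginalPrice (increasingBlockPayment c) q p := by
  have hlevel : ∀ i, 0 ≤ ∑ j, min (q i) (q j) := fun i =>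
    Finset.sum_nonneg fun j _ => le_min (hq i) (hq j)
  have hp : ∀ i, ENNReal.ofReal (c (∑ j, min (q i) (q j))).toReal = c (∑ j, min (q i) (q j)) :=
    fun i => ENNReal.ofReal_toReal <|
      hfin _ (hlevel i) (Finset.sum_le_sum fun j _ => min_le_right _ _)
  refine ⟨fun i => (c (∑ j, min (q i) (q j))).toReal, fun _ => ENNReal.toReal_nonneg,
    isMarginalPrice_increasingBlockPayment hq (fun _ => ENNReal.toReal_nonneg)
      (fun i z hz => ?_) fun i z hz => ?_⟩
  · exact (hc hz.1 (hlevel i) hz.2.le).trans_eq (hp i).symm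
  · exact (hp i).trans_le (hc (hlevel i) ((hlevel i).trans hz.le) hz.le)

theorem load_le_of_sum_min_le {U : ℝ} (hU : 0 ≤ U) (h : ∀ i, ∑ j, min (q i) (q j) ≤ U) :
    load q ≤ U := by
  rcases isEmpty_or_nonempty (Fin N) with _ | _
  · simpa [load] using hU
  · obtain ⟨k, hk⟩ := Finite.exists_max q
    simpa only [load, min_eq_right (hk _)] using h k

theorem exists_demand_isMarginalPrice_increasingBlockPayment {U : ℝ} (hU : 0 ≤ U)
    (hc : MonotoneOn c (Ici 0)) (htop : ∀ z, U < z → c z = ⊤) {ω : Fin N → ℝ}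
    (hω : ∀ i, 0 ≤ ω i) :
    ∃ q : Fin N → ℝ,
      (∀ i, 0 ≤ q i) ∧ load q ≤ U ∧ IsMarginalPrice (increasingBlockPayment c) q ω := by
  choose y hy hlow hhigh using fun i =>
    exists_threshold_of_monotoneOn hU (hc.mono Icc_subset_Ici_self) (ENNReal.ofReal (ω i))
  obtain ⟨q, hq, hqy⟩ := exists_sum_min_eq fun i => (hy i).1
  refine ⟨q, hq, load_le_of_sum_min_le hU fun i => hqy i ▸ (hy i).2,
    isMarginalPrice_increasingBlockPayment hq hω (fun i z hz => ?_) fun i z hz => ?_⟩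
  · exact hlow i z (hqy i ▸ hz)
  · rcases le_or_gt z U with hzU | hUz
    · exact hhigh i z ⟨hqy i ▸ hz, hzU⟩
    · exact le_top.trans_eq (htop z hUz).symm

end IncreasingBlock

namespace IsCostFunction

variable {U : ℝ} {C c : ℝ → ℝ≥0∞}

theorem hasDerivWithinAt_Ico (hC : IsCostFunction U C c) :
    ∀ y ∈ Ico 0 U, HasDerivWithinAt (fun y => (C y).toReal) (c y).toReal (Ico 0 U) y :=
  fun y hy => (hC.hasDerivWithinAt y hy.1 hy.2).mono Ico_subset_Ici_self

theorem monotoneOn_toReal_marginal (hC : IsCostFunction U C c) :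
    MonotoneOn (fun y => (c y).toReal) (Ico 0 U) := fun _ hy _ hz hyz =>
  ENNReal.toReal_mono (hC.marginal_ne_top _ hz.1 hz.2) (hC.marginal_mono hy.1 hz.1 hyz)

theorem continuousOn_toReal_marginal (hC : IsCostFunction U C c) :
    ContinuousOn (fun y => (c y).toReal) (Ico 0 U) :=
  continuousOn_deriv_of_monotoneOn ordConnected_Ico hC.hasDerivWithinAt_Ico
    hC.monotoneOn_toReal_marginal

theorem tangent_le (hC : IsCostFunction U C c) {X Z : ℝ} (hX : X ∈ Ico 0 U) (hZ : Z ∈ Ico 0 U) :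
    (C X).toReal + (c X).toReal * (Z - X) ≤ (C Z).toReal :=
  tangent_le_of_monotoneOn_deriv (convex_Ico 0 U) hC.hasDerivWithinAt_Ico
    hC.monotoneOn_toReal_marginal hX hZ

theorem average_le_marginal (hC : IsCostFunction U C c) {X : ℝ} (hX : X ∈ Ioo 0 U) :
    (C X).toReal / X ≤ (c X).toReal := by
  have h := hC.tangent_le (Ioo_subset_Ico_self hX) (left_mem_Ico.2 (hX.1.trans hX.2))
  rw [hC.cost_zero, ENNReal.toReal_zero] at h
  rw [div_le_iff₀ hX.1]
  linarith

theorem tendsto_cost_capacity (hC : IsCostFunction U C c) : Tendsto C (𝓝[<] U) (𝓝 (C U)) :=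
  hC.left_continuous.mono_left (nhdsWithin_mono _ Iio_subset_Iic_self)

theorem tendsto_toReal_cost_capacity (hC : IsCostFunction U C c) (hfin : C U ≠ ⊤) :
    Tendsto (fun y => (C y).toReal) (𝓝[<] U) (𝓝 (C U).toReal) :=
  (ENNReal.tendsto_toReal hfin).comp hC.tendsto_cost_capacity

theorem tendsto_average_zero (hC : IsCostFunction U C c) (hU : 0 < U) :
    Tendsto (fun y => (C y).toReal / y) (𝓝[>] 0) (𝓝 (c 0).toReal) := by
  have h := (hC.hasDerivWithinAt 0 le_rfl hU).mono Ioi_subset_Ici_self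
  rw [hasDerivWithinAt_iff_tendsto_slope' self_notMem_Ioi] at h
  refine h.congr fun y => ?_
  simp [slope_def_field, hC.cost_zero]

theorem isSubgradient_of_forall_Ico (hC : IsCostFunction U C c) (hU : 0 < U) {X κ : ℝ}
    (hX : C X ≠ ⊤) (h : ∀ Z ∈ Ico 0 U, (C X).toReal + κ * (Z - X) ≤ (C Z).toReal) :
    IsSubgradient C X κ := by
  refine ⟨hX, fun Z hZ hfin => ?_⟩
  rcases lt_trichotomy Z U with hZU | rfl | hUZ
  · exact h Z ⟨hZ, hZU⟩
  · have hlim : Tendsto (fun Y => (C X).toReal + κ * (Y - X)) (𝓝[<] Z)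
        (𝓝 ((C X).toReal + κ * (Z - X))) :=
      (Continuous.tendsto (by fun_prop) Z).mono_left nhdsWithin_le_nhds
    refine le_of_tendsto_of_tendsto hlim (hC.tendsto_toReal_cost_capacity hfin) ?_
    filter_upwards [Ioo_mem_nhdsLT hU] with Y hY using h Y (Ioo_subset_Ico_self hY)
  · exact absurd (hC.cost_eq_top Z hUZ) hfin

theorem isSubgradient_marginal (hC : IsCostFunction U C c) {X : ℝ} (hX : X ∈ Ico 0 U) :
    IsSubgradient C X (c X).toReal :=
  hC.isSubgradient_of_forall_Ico (hX.1.trans_lt hX.2) (hC.cost_ne_top X hX.1 hX.2)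
    fun _ hZ => hC.tangent_le hX hZ

theorem isSubgradient_capacity (hC : IsCostFunction U C c) (hU : 0 < U) (hfin : C U ≠ ⊤) {κ : ℝ}
    (hκ : ∀ Y ∈ Ioo 0 U, (c Y).toReal ≤ κ) : IsSubgradient C U κ := by
  refine hC.isSubgradient_of_forall_Ico hU hfin fun Z hZ => ?_
  have hlim : Tendsto (fun Y => (C Y).toReal + κ * (Z - Y)) (𝓝[<] U)
      (𝓝 ((C U).toReal + κ * (Z - U))) :=
    (hC.tendsto_toReal_cost_capacity hfin).add
      ((Continuous.tendsto (by fun_prop) U).mono_left nhdsWithin_le_nhds)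
  refine le_of_tendsto hlim ?_
  filter_upwards [Ioo_mem_nhdsLT hZ.2] with Y hY
  have hY0 : 0 < Y := hZ.1.trans_lt hY.1
  have htangent := hC.tangent_le ⟨hY0.le, hY.2⟩ hZ
  have hslope := mul_le_mul_of_nonneg_right (hκ Y ⟨hY0, hY.2⟩) (sub_pos.2 hY.1).le
  linarith

theorem average_le_marginal_zero_of_isSubgradient (hC : IsCostFunction U C c) (hU : 0 < U) {X : ℝ}
    (hX : 0 < X) (h : IsSubgradient C X ((C X).toReal / X)) :
    (C X).toReal / X ≤ (c 0).toReal := by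
  refine ge_of_tendsto (hC.tendsto_average_zero hU) ?_
  filter_upwards [Ioo_mem_nhdsGT hU] with Z hZ
  have hZX := h.2 Z hZ.1.le (hC.cost_ne_top Z hZ.1.le hZ.2)
  rw [mul_sub, div_mul_cancel₀ _ hX.ne'] at hZX
  rw [le_div_iff₀ hZ.1]
  linarith

variable {Ψ : ℝ → ℝ} {W : ℝ}

theorem cost_capacity_ne_top_of_marginal_lt (hC : IsCostFunction U C c) (hU : 0 < U)
    (hW : ∀ a, W ≤ a → Ψ a ≤ a)
    (hlt : ∀ Y ∈ Ioo 0 U, (c Y).toReal < Ψ ((C Y).toReal / Y)) : C U ≠ ⊤ := by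
  have hlim : Tendsto (fun Y => ENNReal.ofReal (W * Y)) (𝓝[<] U) (𝓝 (ENNReal.ofReal (W * U))) :=
    (ENNReal.continuous_ofReal.comp (continuous_const_mul W)).continuousAt.tendsto.mono_left
      nhdsWithin_le_nhds
  refine ne_top_of_le_ne_top ENNReal.ofReal_ne_top
    (le_of_tendsto_of_tendsto hC.tendsto_cost_capacity hlim ?_)
  filter_upwards [Ioo_mem_nhdsLT hU] with Y hY
  have haverage : (C Y).toReal / Y ≤ W := by
    by_contra! h
    exact ((hC.average_le_marginal hY).trans_lt (hlt Y hY)).not_ge (hW _ h.le)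
  rw [← ENNReal.ofReal_toReal (hC.cost_ne_top Y hY.1.le hY.2)]
  exact ENNReal.ofReal_le_ofReal ((div_le_iff₀ hY.1).1 haverage)

theorem isSubgradient_capacity_of_marginal_lt (hC : IsCostFunction U C c) (hU : 0 < U)
    (hΨ : Continuous Ψ) (hfin : C U ≠ ⊤)
    (hlt : ∀ Y ∈ Ioo 0 U, (c Y).toReal < Ψ ((C Y).toReal / Y)) :
    IsSubgradient C U (Ψ ((C U).toReal / U)) := by
  refine hC.isSubgradient_capacity hU hfin fun Y hY => ?_
  have hlim : Tendsto (fun y => Ψ ((C y).toReal / y)) (𝓝[<] U) (𝓝 (Ψ ((C U).toReal / U))) :=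
    (hΨ.tendsto _).comp
      ((hC.tendsto_toReal_cost_capacity hfin).div (tendsto_id.mono_left nhdsWithin_le_nhds) hU.ne')
  refine ge_of_tendsto hlim ?_
  filter_upwards [Ioo_mem_nhdsLT hY.2] with y hy
  have hy0 : 0 < y := hY.1.trans hy.1
  exact (hC.monotoneOn_toReal_marginal (Ioo_subset_Ico_self hY) ⟨hy0.le, hy.2⟩ hy.1.le).trans
    (hlt y ⟨hy0, hy.2⟩).le

theorem exists_marginal_lt (hC : IsCostFunction U C c) (hU : 0 < U) (hΨ : Continuous Ψ)
    (h0 : (c 0).toReal < Ψ (c 0).toReal) :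
    ∃ Y ∈ Ioo 0 U, (c Y).toReal < Ψ ((C Y).toReal / Y) := by
  have hc : Tendsto (fun y => (c y).toReal) (𝓝[>] 0) (𝓝 (c 0).toReal) := by
    rw [← nhdsWithin_Ioo_eq_nhdsGT hU]
    exact (hC.continuousOn_toReal_marginal 0 (left_mem_Ico.2 hU)).mono Ioo_subset_Ico_self
  have hlt := hc.eventually_lt ((hΨ.tendsto _).comp (hC.tendsto_average_zero hU)) h0
  obtain ⟨Y, hYlt, hY⟩ := (hlt.and (Ioo_mem_nhdsGT hU)).exists
  exact ⟨Y, hY, hYlt⟩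

theorem exists_isSubgradient_comp_average (hC : IsCostFunction U C c) (hU : 0 < U)
    (hΨ : Continuous Ψ) (hW : ∀ a, W ≤ a → Ψ a ≤ a) (h0 : (c 0).toReal < Ψ (c 0).toReal) :
    ∃ X ∈ Ioc 0 U, IsSubgradient C X (Ψ ((C X).toReal / X)) := by
  by_cases hge : ∃ Z ∈ Ioo 0 U, Ψ ((C Z).toReal / Z) ≤ (c Z).toReal
  · obtain ⟨Z, hZ, hZge⟩ := hge
    obtain ⟨Y, hY, hYlt⟩ := hC.exists_marginal_lt hU hΨ h0
    have haverage : ContinuousOn (fun y => (C y).toReal / y) (Ioo 0 U) := fun y hy =>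
      ((hC.hasDerivWithinAt_Ico y (Ioo_subset_Ico_self hy)).continuousWithinAt.mono
        Ioo_subset_Ico_self).div continuousWithinAt_id hy.1.ne'
    obtain ⟨X, hX, hXeq : (c X).toReal = Ψ ((C X).toReal / X)⟩ :=
      isPreconnected_Ioo.intermediate_value₂ hY hZ
        (hC.continuousOn_toReal_marginal.mono Ioo_subset_Ico_self)
        (hΨ.comp_continuousOn haverage) hYlt.le hZge
    exact ⟨X, Ioo_subset_Ioc_self hX, hXeq ▸ hC.isSubgradient_marginal (Ioo_subset_Ico_self hX)⟩
  · push Not at hge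
    exact ⟨U, right_mem_Ioc.2 hU, hC.isSubgradient_capacity_of_marginal_lt hU hΨ
      (hC.cost_capacity_ne_top_of_marginal_lt hU hW hge) hge⟩

end IsCostFunction

section AverageCost

variable {C : ℝ → ℝ≥0∞} {q : Fin N → ℝ}

theorem load_nonneg (hq : ∀ i, 0 ≤ q i) : 0 ≤ load q := Finset.sum_nonneg fun i _ => hq i

theorem le_load (hq : ∀ i, 0 ≤ q i) (i : Fin N) : q i ≤ load q :=
  Finset.single_le_sum (fun j _ => hq j) (Finset.mem_univ i)

theorem load_update (q : Fin N → ℝ) (i : Fin N) (d : ℝ) :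
    load (Function.update q i d) = load q + (d - q i) := by
  rw [load, load, Finset.sum_update_of_mem (Finset.mem_univ i), Finset.sdiff_singleton_eq_erase,
    ← Finset.add_sum_erase _ q (Finset.mem_univ i)]
  ring

theorem averageCostPayment_update_self (C : ℝ → ℝ≥0∞) (q : Fin N → ℝ) (i : Fin N) (d : ℝ) :
    averageCostPayment C (Function.update q i d) i =
      ENNReal.ofReal d * (C (load q + (d - q i)) / ENNReal.ofReal (load q + (d - q i))) := by
  rw [averageCostPayment, averageCost, load_update, Function.update_self]

theorem averageCostPayment_update_zero (hC : C 0 = 0) (i : Fin N) {d : ℝ} (hd : 0 ≤ d) :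
    averageCostPayment C (Function.update 0 i d) i = C d := by
  rcases hd.eq_or_lt with rfl | hd
  · simp [averageCostPayment, hC]
  · rw [averageCostPayment_update_self]
    simpa [load] using
      ENNReal.mul_div_cancel (ENNReal.ofReal_pos.2 hd).ne' ENNReal.ofReal_ne_top

theorem isMarginalPrice_averageCostPayment_zero (hC : C 0 = 0) {κ : ℝ} (hκ : IsSubgradient C 0 κ)
    {p : Fin N → ℝ} (hp : ∀ i, p i ≤ κ) : IsMarginalPrice (averageCostPayment C) 0 p := fun i =>
  (hκ.mono_at_zero (hp i)).congr le_rfl fun _ hd => (averageCostPayment_update_zero hC i hd).symm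

theorem average_payment_tangent_le {a κ q X d G : ℝ} (hd : 0 < d) (hqX : q ≤ X) (hX : 0 < X)
    (haκ : a ≤ κ) (hG : a * X + κ * (d - q) ≤ G) :
    q * a + (a + q / X * (κ - a)) * (d - q) ≤ d * (G / (X + (d - q))) := by
  have hZ : 0 < X + (d - q) := by linarith
  have hgap : d * ((a * X + κ * (d - q)) / (X + (d - q))) -
      (q * a + (a + q / X * (κ - a)) * (d - q)) =
      (κ - a) * (d - q) ^ 2 * (X - q) / (X * (X + (d - q))) := by
    field_simp
    ring
  have hgap_nonneg : 0 ≤ (κ - a) * (d - q) ^ 2 * (X - q) / (X * (X + (d - q))) := by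
    have := sub_nonneg.2 haκ
    have := sub_nonneg.2 hqX
    positivity
  calc q * a + (a + q / X * (κ - a)) * (d - q)
      ≤ d * ((a * X + κ * (d - q)) / (X + (d - q))) := by linarith
    _ ≤ d * (G / (X + (d - q))) := by gcongr

theorem isMarginalPrice_averageCostPayment {a κ : ℝ} (hC : C 0 = 0) (hq : ∀ i, 0 ≤ q i)
    (hload : 0 < load q) (hκ : IsSubgradient C (load q) κ)
    (ha : (C (load q)).toReal / load q = a) :
    IsMarginalPrice (averageCostPayment C) q fun i => a + q i / load q * (κ - a) := by
  have haκ : a ≤ κ := ha ▸ hκ.div_le hC hload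
  have hcost : (C (load q)).toReal = a * load q := by rw [← ha, div_mul_cancel₀ _ hload.ne']
  intro i
  simp only [IsSubgradient, averageCostPayment_update_self, sub_self, add_zero]
  refine ⟨ENNReal.mul_ne_top ENNReal.ofReal_ne_top
    (ENNReal.div_ne_top hκ.1 (ENNReal.ofReal_pos.2 hload).ne'), fun d hd hfin => ?_⟩
  rw [ENNReal.toReal_mul, ENNReal.toReal_div, ENNReal.toReal_ofReal (hq i),
    ENNReal.toReal_ofReal hload.le, ha]
  rcases hd.eq_or_lt with rfl | hd
  · have : 0 ≤ q i / load q * (κ - a) * q i :=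
      mul_nonneg (mul_nonneg (div_nonneg (hq i) hload.le) (sub_nonneg.2 haκ)) (hq i)
    simp only [ENNReal.ofReal_zero, zero_mul, ENNReal.toReal_zero]
    linarith
  · have hZ : 0 ≤ load q + (d - q i) := by linarith [le_load hq i]
    have hCfin : C (load q + (d - q i)) ≠ ⊤ := fun htop => hfin <| by
      rw [htop, ENNReal.top_div_of_ne_top ENNReal.ofReal_ne_top,
        ENNReal.mul_top (ENNReal.ofReal_pos.2 hd).ne']
    rw [ENNReal.toReal_mul, ENNReal.toReal_div, ENNReal.toReal_ofReal hd.le,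
      ENNReal.toReal_ofReal hZ]
    refine average_payment_tangent_le hd (le_load hq i) hload haκ ?_
    simpa [hcost] using hκ.2 _ hZ hCfin

theorem exists_isMarginalPrice_averageCostPayment {U : ℝ} {c : ℝ → ℝ≥0∞}
    (hC : IsCostFunction U C c) (hq : ∀ i, 0 ≤ q i) (hload : load q < U) :
    ∃ p : Fin N → ℝ, (∀ i, 0 ≤ p i) ∧ IsMarginalPrice (averageCostPayment C) q p := by
  have hκ := hC.isSubgradient_marginal ⟨load_nonneg hq, hload⟩
  rcases (load_nonneg hq).eq_or_lt with h0 | hpos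
  · obtain rfl : q = 0 := funext fun i =>
      le_antisymm ((le_load hq i).trans_eq h0.symm) (hq i)
    rw [← h0] at hκ
    exact ⟨0, fun _ => le_rfl,
      isMarginalPrice_averageCostPayment_zero hC.cost_zero hκ fun _ => ENNReal.toReal_nonneg⟩
  · refine ⟨_, fun i => ?_, isMarginalPrice_averageCostPayment hC.cost_zero hq hpos hκ rfl⟩
    exact add_nonneg (div_nonneg ENNReal.toReal_nonneg hpos.le)
      (mul_nonneg (div_nonneg (hq i) hpos.le) (sub_nonneg.2 (hκ.div_le hC.cost_zero hpos)))

/-- The total excess `∑ i, (ω i - a)⁺` of the revenue rates over the average price `a`. In an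
equilibrium of average-cost pricing it is the gap between the marginal and the average price. -/
def excessRate (ω : Fin N → ℝ) (a : ℝ) : ℝ := ∑ i, max 0 (ω i - a)

variable {ω : Fin N → ℝ} {a : ℝ}

theorem continuous_excessRate (ω : Fin N → ℝ) : Continuous (excessRate ω) := by
  unfold excessRate
  fun_prop

theorem excessRate_nonneg (ω : Fin N → ℝ) (a : ℝ) : 0 ≤ excessRate ω a :=
  Finset.sum_nonneg fun _ _ => le_max_left _ _

theorem excessRate_eq_zero (h : ∀ i, ω i ≤ a) : excessRate ω a = 0 :=
  Finset.sum_eq_zero fun i _ => max_eq_left (sub_nonpos.2 (h i))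

theorem excessRate_pos {k : Fin N} (hk : a < ω k) : 0 < excessRate ω a :=
  Finset.sum_pos' (fun _ _ => le_max_left _ _)
    ⟨k, Finset.mem_univ k, lt_max_of_lt_right (sub_pos.2 hk)⟩

theorem exists_isSubgradient_add_excessRate {U : ℝ} {c : ℝ → ℝ≥0∞} (hC : IsCostFunction U C c)
    (hU : 0 < U) {k : Fin N} (hk : (c 0).toReal < ω k) :
    ∃ X ∈ Ioc 0 U, 0 < excessRate ω ((C X).toReal / X) ∧
      IsSubgradient C X ((C X).toReal / X + excessRate ω ((C X).toReal / X)) := by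
  obtain ⟨W, hW⟩ := (finite_range ω).bddAbove
  obtain ⟨X, hX, hsub⟩ := hC.exists_isSubgradient_comp_average (Ψ := fun a => a + excessRate ω a)
    hU (continuous_id.add (continuous_excessRate ω))
    (fun a ha => by rw [excessRate_eq_zero fun i => (hW (mem_range_self i)).trans ha, add_zero])
    (lt_add_of_pos_right _ (excessRate_pos hk))
  refine ⟨X, hX, (excessRate_nonneg ω _).lt_of_ne' fun hzero => ?_, hsub⟩
  rw [hzero, add_zero] at hsub
  have hlow := hC.average_le_marginal_zero_of_isSubgradient hU hX.1 hsub
  exact (excessRate_pos (hlow.trans_lt hk)).ne' hzero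

theorem exists_demand_isMarginalPrice_of_isSubgradient (hC : C 0 = 0) {X : ℝ} (hX : 0 < X)
    (ha : (C X).toReal / X = a) (hpos : 0 < excessRate ω a)
    (hκ : IsSubgradient C X (a + excessRate ω a)) :
    ∃ q : Fin N → ℝ,
      (∀ i, 0 ≤ q i) ∧ load q = X ∧ IsMarginalPrice (averageCostPayment C) q ω := by
  set q : Fin N → ℝ := fun i => max 0 (ω i - a) / excessRate ω a * X with hq_def
  have hq : ∀ i, 0 ≤ q i := fun i => by positivity
  have hload : load q = X := by
    rw [load, ← Finset.sum_mul, ← Finset.sum_div, ← excessRate, div_self hpos.ne', one_mul]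
  have hprice : ∀ i, a + q i / X * (a + excessRate ω a - a) = a + max 0 (ω i - a) := fun i => by
    rw [mul_div_cancel_right₀ _ hX.ne', add_sub_cancel_left, div_mul_cancel₀ _ hpos.ne']
  refine ⟨q, hq, hload, ?_⟩
  have h := isMarginalPrice_averageCostPayment hC hq (hload ▸ hX) (hload.symm ▸ hκ)
    (hload.symm ▸ ha)
  simp only [hload, hprice] at h
  refine h.mono fun i => ?_
  rcases le_total (ω i) a with hi | hi
  · have hmax : max 0 (ω i - a) = 0 := max_eq_left (sub_nonpos.2 hi)
    exact .inr ⟨by simp [hq_def, hmax], by rwa [hmax, add_zero]⟩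
  · exact .inl (by rw [max_eq_right (sub_nonneg.2 hi), add_sub_cancel])

theorem exists_demand_isMarginalPrice_averageCostPayment {U : ℝ} {c : ℝ → ℝ≥0∞}
    (hC : IsCostFunction U C c) (hU : 0 < U) (ω : Fin N → ℝ) :
    ∃ q : Fin N → ℝ,
      (∀ i, 0 ≤ q i) ∧ load q ≤ U ∧ IsMarginalPrice (averageCostPayment C) q ω := by
  by_cases hω : ∀ i, ω i ≤ (c 0).toReal
  · refine ⟨0, fun _ => le_rfl, ?_, isMarginalPrice_averageCostPayment_zero hC.cost_zero
      (hC.isSubgradient_marginal (left_mem_Ico.2 hU)) hω⟩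
    simpa [load] using hU.le
  · push Not at hω
    obtain ⟨k, hk⟩ := hω
    obtain ⟨X, hX, hpos, hκ⟩ := exists_isSubgradient_add_excessRate hC hU hk
    obtain ⟨q, hq, hload, hprice⟩ :=
      exists_demand_isMarginalPrice_of_isSubgradient hC.cost_zero hX.1 rfl hpos hκ
    exact ⟨q, hq, hload.trans_le hX.2, hprice⟩

end AverageCost

namespace IsCostFunction

variable {U : ℝ} {C c : ℝ → ℝ≥0∞}

theorem exists_isMarginalPrice (hC : IsCostFunction U C c) (scheme : PricingScheme)
    {q : Fin N → ℝ} (hq : ∀ i, 0 ≤ q i) (hload : load q < U) :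
    ∃ p : Fin N → ℝ, (∀ i, 0 ≤ p i) ∧ IsMarginalPrice (scheme.payment C c) q p := by
  cases scheme with
  | averageCost => exact exists_isMarginalPrice_averageCostPayment hC hq hload
  | increasingBlock =>
    exact exists_isMarginalPrice_increasingBlockPayment hC.marginal_mono hq fun z hz hzl =>
      hC.marginal_ne_top z hz (hzl.trans_lt hload)

theorem exists_demand_isMarginalPrice (hC : IsCostFunction U C c) (scheme : PricingScheme)
    (hU : 0 < U) {ω : Fin N → ℝ} (hω : ∀ i, 0 ≤ ω i) :
    ∃ q : Fin N → ℝ,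
      (∀ i, 0 ≤ q i) ∧ load q ≤ U ∧ IsMarginalPrice (scheme.payment C c) q ω := by
  cases scheme with
  | averageCost => exact exists_demand_isMarginalPrice_averageCostPayment hC hU ω
  | increasingBlock =>
    exact exists_demand_isMarginalPrice_increasingBlockPayment hU.le hC.marginal_mono
      hC.marginal_eq_top hω

end IsCostFunction

end LoadBalancing

theorem mainTheorem1 (N T : ℕ) (U : ℝ) (C c : ℝ → ℝ≥0∞)
    (hC : LoadBalancing.IsCostFunction U C c) (scheme : LoadBalancing.PricingScheme) :
    (∀ β : Fin N → ℝ, (∀ i, 0 ≤ β i) → ∑ i, β i < (T : ℝ) * U →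
      ∃ x : Fin N → Fin T → ℝ,
        LoadBalancing.IsNEP (scheme.payment C c) LoadBalancing.zeroRevenue β x ∧
        LoadBalancing.IsServable (scheme.payment C c) U x) ∧
    (∀ ω : Fin N → Fin T → ℝ, (∀ i t, 0 ≤ ω i t) → 0 < (T : ℝ) * U →
      ∃ x : Fin N → Fin T → ℝ,
        LoadBalancing.IsNEP (scheme.payment C c) (LoadBalancing.constantRateRevenue ω)
          (fun _ => 0) x ∧
        LoadBalancing.IsServable (scheme.payment C c) U x) := by
  refine ⟨fun β hβ hsum => ?_, fun ω hω hTU => ?_⟩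
  · have hT : 0 < T := by
      rcases T.eq_zero_or_pos with rfl | hT
      · exact absurd (Finset.sum_nonneg fun i _ => hβ i) (by simpa using hsum)
      · exact hT
    have hload : LoadBalancing.load (fun i => β i / T) < U := by
      rwa [LoadBalancing.load, ← Finset.sum_div, div_lt_iff₀' (Nat.cast_pos.2 hT)]
    obtain ⟨p, hp0, hp⟩ :=
      hC.exists_isMarginalPrice scheme (fun i => div_nonneg (hβ i) T.cast_nonneg) hload
    exact LoadBalancing.exists_isNEP_zeroRevenue hT hβ hload.le hp0 hp
  · have hU : 0 < U := pos_of_mul_pos_right hTU T.cast_nonneg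
    exact LoadBalancing.exists_isNEP_constantRateRevenue fun t =>
      hC.exists_demand_isMarginalPrice scheme hU fun i => hω i t
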